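/- Let $d,D,J\ge 1$ be integers, $1\le p<\infty$, and let $\sigma:\mathbb R\to\mathbb R$ be continuous and not a polynomial. Let $\mu$ be a $\sigma$-finite Borel measure on $\mathbb R^d$, absolutely continuous with respect to Lebesgue measure, and let $(K_n)_{n\ge1}$ be compact subsets of $\mathbb R^d$ with $0<\mu(K_n)<\infty$, $\mu(K_n\cap K_m)=0$ for $n\ne m$, and $\mu(\mathbb R^d\setminus\bigcup_nK_n)=0$. *Networks.* A feedforward network of depth $j\ge1$ is a map $f=W\circ f^{(j)}:\mathbb R^d\to\mathbb R^D$ with $f^{(0)}(x)=x$, $f^{(i)}(x)=\sigma\bullet W^{(i)}(f^{(i-1)}(x))$ for $1\le i\le j$, where $W,W^{(i)}$ are affine maps between Euclidean spaces (arbitrary intermediate dimensions) and $\bullet$ is componentwise application. $\mathrm{NN}_J$ is the set of networks of depth at most $J$. *Spaces.* $L^p_{\mu,\mathrm{loc}}$ is the set of $\mu$-a.e. classes of functions $\mathbb R^d\to\mathbb R^D$ that are $p$-integrable on every compact set, with its usual topology $\tau_{\mathrm{loc}}$ of $L^p$-convergence on each compact set. For $n\ge1$, $L^p_{\mu:n}$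 is the space of $f\in L^p_{\mu,\mathrm{loc}}$ with essential support in $K_1\cup\dots\cup K_n$, normed by $\max_{i\le n}\big(\int\|f I_{K_i}\|^p\,d\mu\big)^{1/p}$; $\tau_\infty$ is the finest topology on $\bigcup_nL^p_{\mu:n}$ making all the inclusions of the $L^p_{\mu:n}$ continuous. $L^p_{\mu,\mathrm{strict}}$ is the set $L^p_{\mu,\mathrm{loc}}$ with the smallest topology containing $\tau_\infty$, the norm topology of $L^p_\mu$, and $\tau_{\mathrm{loc}}$ (the members of the first two being regarded as subsets of $L^p_{\mu,\mathrm{loc}}$). *Architopes.* For a set $F$ of functions $\mathbb R^d\to\mathbb R^D$, $F\text{-tope}\subseteq L^p_{\mu,\mathrm{loc}}$ is the set of those elements of $L^p_{\mu,\mathrm{loc}}$ that are $\mu$-a.e. equal to $\sum_{i=1}^n\beta_iI_{K_i}f_i+\beta_0I_{\mathbb R^d\setminus(K_1\cup\dots\cup K_n)}f_0$ for some $n\ge1$, $f_0,\dots,f_n\in F$, and reals $\beta_0,\dots,\beta_n$ that are not all zero. Likewise, below, $\mathrm{NN}_j$ also stands for the set of those elements of $L^p_{\mu,\mathrm{loc}}$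 that are classes of members of $\mathrm{NN}_j$. Then: (i) $\mathrm{NN}_J\text{-tope}$ is dense in $L^p_{\mu,\mathrm{strict}}$. (ii) For every $\delta>0$ and $f\in L^p_\mu(\mathbb R^d,\mathbb R^D)$ there is $f^\delta\in\mathrm{NN}_J\text{-tope}$ with $\int\|f-f^\delta\|^p\,d\mu<\delta$. (iii) For every topology on the set $L^p_{\mu,\mathrm{loc}}$, if one of $\mathrm{NN}_1,\dots,\mathrm{NN}_J$ is dense then $\mathrm{NN}_J\text{-tope}$ is dense. The converse fails whenever $\mathrm{NN}_J\ne\mathrm{NN}_J\text{-tope}$ as subsets of $L^p_{\mu,\mathrm{loc}}$: there is then a topology on $L^p_{\mu,\mathrm{loc}}$ for which $\mathrm{NN}_J\text{-tope}$ is dense but none of $\mathrm{NN}_1,\dots,\mathrm{NN}_J$ is. Moreover, $\mathrm{NN}_J\ne\mathrm{NN}_J\text{-tope}$ holds whenever the support of $\mu$ is connected, for instance when $\mu$ is Lebesgue measure. -/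

import Mathlib

open MeasureTheory Set Topology
open scoped ENNReal

namespace Architope

/-- The Euclidean space `ℝⁿ`. -/
abbrev Eu (n : ℕ) : Type := EuclideanSpace ℝ (Fin n)

/-! ### Feedforward networks -/

/-- `σ • x`: the activation function applied component by component. -/
noncomputable def act (σ : ℝ → ℝ) {n : ℕ} (x : Eu n) : Eu n :=
  WithLp.toLp 2 (fun i => σ (x i))

/-- `IsHidden σ d j m g`: the map `g : ℝ^d → ℝ^m` is of the form `f^(j)`, where `f^(0)(x) = x` and
`f^(j)(x) = σ • W^(j)(f^(j-1)(x))` with affine maps `W^(j)` between spaces of arbitrary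
dimensions. -/
inductive IsHidden (σ : ℝ → ℝ) (d : ℕ) : ℕ → (m : ℕ) → (Eu d → Eu m) → Prop
  | input : IsHidden σ d 0 d (fun x => x)
  | layer {j m k : ℕ} {g : Eu d → Eu m} (hg : IsHidden σ d j m g) (W : Eu m →ᵃ[ℝ] Eu k) :
      IsHidden σ d (j + 1) k (fun x => act σ (W (g x)))

/-- `f : ℝ^d → ℝ^D` is a feedforward network of depth exactly `j`: `f = W ∘ f^(j)`, `W` affine. -/
def IsNetwork (σ : ℝ → ℝ) (d D j : ℕ) (f : Eu d → Eu D) : Prop :=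
  ∃ (m : ℕ) (g : Eu d → Eu m) (W : Eu m →ᵃ[ℝ] Eu D), IsHidden σ d j m g ∧ f = fun x => W (g x)

/-- The networks from `ℝ^d` to `ℝ^D` of (positive) depth at most `J`. -/
def NN (σ : ℝ → ℝ) (d D J : ℕ) : Set (Eu d → Eu D) :=
  {f | ∃ j, 1 ≤ j ∧ j ≤ J ∧ IsNetwork σ d D j f}

/-! ### Partitions; locally `p`-integrable functions -/

/-- A partition of `ℝ^d` up to `μ`-null sets into compact sets, indexed by `ℕ` (so that `K i` is
the `(i+1)`-st set). -/
structure IsPartition {d : ℕ} (μ : Measure (Eu d)) (K : ℕ → Set (Eu d)) : Prop where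
  isCompact : ∀ n, IsCompact (K n)
  compl_null : μ (⋃ n, K n)ᶜ = 0
  inter_null : ∀ n m, n ≠ m → μ (K n ∩ K m) = 0

/-- `L^p_{μ,loc}(ℝ^d, ℝ^D)`: the `μ`-a.e. classes of functions that are `p`-integrable on each
compact set. -/
def LpLoc (d D : ℕ) (p : ℝ≥0∞) (μ : Measure (Eu d)) : Type :=
  {f : Eu d →ₘ[μ] Eu D // ∀ C : Set (Eu d), IsCompact C → MemLp f p (μ.restrict C)}

variable {d D : ℕ} {p : ℝ≥0∞} {μ : Measure (Eu d)}

/-- A representative of an element of `L^p_{μ,loc}`. -/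
noncomputable def LpLoc.fn (f : LpLoc d D p μ) : Eu d → Eu D := f.1

/-- The elements of `L^p_{μ,loc}` that are classes of members of `F`. -/
def classes (p : ℝ≥0∞) (μ : Measure (Eu d)) (F : Set (Eu d → Eu D)) : Set (LpLoc d D p μ) :=
  {g | ∃ f ∈ F, g.fn =ᵐ[μ] f}

/-- The function `∑_{i=1}^n β_i I_{K_i} f_i + β_0 I_{ℝ^d - ⋃_{i=1}^n K_i} f_0`. -/
noncomputable def architopeFn (K : ℕ → Set (Eu d)) (n : ℕ) (β : Fin n → ℝ) (f : Fin n → Eu d → Eu D)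
    (β₀ : ℝ) (f₀ : Eu d → Eu D) (x : Eu d) : Eu D :=
  (∑ i : Fin n, β i • (K i).indicator (f i) x) + β₀ • (⋃ i : Fin n, K i)ᶜ.indicator f₀ x

/-- The architope upgrade of `F`, a set of classes in `L^p_{μ,loc}`. -/
def tope (p : ℝ≥0∞) (μ : Measure (Eu d)) (K : ℕ → Set (Eu d)) (F : Set (Eu d → Eu D)) :
    Set (LpLoc d D p μ) :=
  {g | ∃ (n : ℕ) (β : Fin n → ℝ) (f : Fin n → Eu d → Eu D) (β₀ : ℝ) (f₀ : Eu d → Eu D),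
    1 ≤ n ∧ (∀ i, f i ∈ F) ∧ f₀ ∈ F ∧ (β₀ ≠ 0 ∨ ∃ i, β i ≠ 0) ∧
    g.fn =ᵐ[μ] architopeFn K n β f β₀ f₀}

/-! ### The topologies -/

/-- The restriction map `L^p_{μ,loc} → L^p(C, μ)`, for a compact set `C`. -/
noncomputable def LpLoc.restr {C : Set (Eu d)} (hC : IsCompact C) (f : LpLoc d D p μ) :
    Lp (Eu D) p (μ.restrict C) :=
  MemLp.toLp f.fn (f.2 C hC)

/-- The usual (Fréchet) topology of `L^p_{μ,loc}`, that of `L^p`-convergence on each compact set. -/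
@[reducible]
noncomputable def tauLoc (d D : ℕ) (p : ℝ≥0∞) [Fact (1 ≤ p)] (μ : Measure (Eu d)) :
    TopologicalSpace (LpLoc d D p μ) :=
  ⨅ (C : Set (Eu d)) (hC : IsCompact C),
    TopologicalSpace.induced (LpLoc.restr hC) inferInstance

/-- The inclusion of `L^p_μ` in `L^p_{μ,loc}`. -/
def ofLp (f : Lp (Eu D) p μ) : LpLoc d D p μ :=
  ⟨f.1, fun C _ => (Lp.memLp f).restrict C⟩

/-- The essential support of `f` with respect to `μ`. -/
def essSupport (μ : Measure (Eu d)) (f : Eu d → Eu D) : Set (Eu d) :=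
  (⋃₀ {U : Set (Eu d) | IsOpen U ∧ ∀ᵐ x ∂μ, x ∈ U → ‖f x‖ = 0})ᶜ

/-- The set `L^p_{μ:n}` of the elements of `L^p_{μ,loc}` with essential support in the union of the
first `n` sets of the partition. -/
def compositeSet (D : ℕ) (p : ℝ≥0∞) (μ : Measure (Eu d)) (K : ℕ → Set (Eu d)) (n : ℕ) :
    Set (LpLoc d D p μ) :=
  {f | essSupport μ f.fn ⊆ ⋃ i : Fin n, K i}

/-- The norm `‖f‖_{p:n} = max_{i = 1, …, n} (∫ ‖f I_{K_i}‖^p dμ)^{1/p}`, as an extended real. -/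
noncomputable def compositeNorm (p : ℝ≥0∞) (μ : Measure (Eu d)) (K : ℕ → Set (Eu d)) (n : ℕ)
    (f : Eu d → Eu D) : ℝ≥0∞ :=
  ⨆ i : Fin n, eLpNorm ((K i).indicator f) p μ

/-- The topology of the norm `‖·‖_{p:n}` on `L^p_{μ:n}`. (The sets `K_i` being of finite measure with
null intersections, the space is already complete.) -/
@[reducible]
def tauComposite (D : ℕ) (p : ℝ≥0∞) (μ : Measure (Eu d)) (K : ℕ → Set (Eu d)) (n : ℕ) :
    TopologicalSpace (compositeSet D p μ K n) where
  IsOpen U := ∀ f ∈ U, ∃ ε : ℝ≥0∞, 0 < ε ∧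
    ∀ g : compositeSet D p μ K n, compositeNorm p μ K n (g.1.fn - f.1.fn) < ε → g ∈ U
  isOpen_univ := fun _ _ => ⟨1, one_pos, fun _ _ => mem_univ _⟩
  isOpen_inter := by
    rintro U V hU hV f ⟨hfU, hfV⟩
    obtain ⟨a, ha, hUa⟩ := hU f hfU
    obtain ⟨b, hb, hVb⟩ := hV f hfV
    exact ⟨min a b, lt_min ha hb, fun g hg =>
      ⟨hUa g (hg.trans_le (min_le_left _ _)), hVb g (hg.trans_le (min_le_right _ _))⟩⟩
  isOpen_sUnion := by
    rintro S hS f ⟨U, hUS, hfU⟩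
    obtain ⟨a, ha, hUa⟩ := hS U hUS f hfU
    exact ⟨a, ha, fun g hg => ⟨U, hUS, hUa g hg⟩⟩

/-- The set `L^p_{μ:∞} = ⋃_{n ≥ 1} L^p_{μ:n}`. -/
def compositeUnion (D : ℕ) (p : ℝ≥0∞) (μ : Measure (Eu d)) (K : ℕ → Set (Eu d)) :
    Set (LpLoc d D p μ) :=
  {f | ∃ n, 1 ≤ n ∧ f ∈ compositeSet D p μ K n}

/-- The inclusion of `L^p_{μ:n}` in `L^p_{μ:∞}`, for `n ≥ 1`. -/
def toUnion (D : ℕ) (p : ℝ≥0∞) (μ : Measure (Eu d)) (K : ℕ → Set (Eu d)) {n : ℕ} (hn : 1 ≤ n)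
    (f : compositeSet D p μ K n) : compositeUnion D p μ K :=
  ⟨f.1, n, hn, f.2⟩

/-- The topology `τ_∞` of `L^p_{μ:∞}`: the final (finest) topology for the inclusions of the
`L^p_{μ:n}`, `n ≥ 1`. -/
@[reducible]
def tauInfty (D : ℕ) (p : ℝ≥0∞) (μ : Measure (Eu d)) (K : ℕ → Set (Eu d)) :
    TopologicalSpace (compositeUnion D p μ K) :=
  ⨆ (n : ℕ) (hn : 1 ≤ n),
    TopologicalSpace.coinduced (toUnion D p μ K hn) (tauComposite D p μ K n)

/-- The topology of `L^p_{μ,strict}`: the smallest topology on `L^p_{μ,loc}` in which the members of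
`τ_∞` (subsets of `L^p_{μ:∞}`), of the norm topology of `L^p_μ` (subsets of `L^p_μ`) and of the
topology of `L^p_{μ,loc}` are open. -/
@[reducible]
noncomputable def tauStrict (D : ℕ) (p : ℝ≥0∞) [Fact (1 ≤ p)] (μ : Measure (Eu d)) (K : ℕ → Set (Eu d)) :
    TopologicalSpace (LpLoc d D p μ) :=
  TopologicalSpace.generateFrom
    ({O | ∃ U : Set (compositeUnion D p μ K), IsOpen[tauInfty D p μ K] U ∧ O = Subtype.val '' U} ∪
     {O | ∃ V : Set (Lp (Eu D) p μ), IsOpen V ∧ O = ofLp '' V} ∪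
     {O | IsOpen[tauLoc d D p μ] O})

/-- `A` is dense for the topology `τ`. -/
def DenseFor {X : Type*} (τ : TopologicalSpace X) (A : Set X) : Prop :=
  @Dense X τ A

end Architope

open Architope

namespace Architope

open Filter
open scoped Polynomial

/-! ### Functionals annihilating the ridge functions of a non-polynomial activation. -/

section Polynomial

open scoped Convolution ContDiff

/-! Everything rests on universal approximation by depth-one networks on a compact set `C`. By
Hahn–Banach, it suffices that a functional `L` on `C(C, ℝ)` killing every `σ(⟪w, x⟫ + b)` is zero.
Averaging over `b`, `L` also kills the ridge functions of the mollifications `φ ⋆ σ`.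
Differentiating these `k` times in the slope, at slope 0, gives `(φ ⋆ σ)⁽ᵏ⁾(b) L(uᵏ) = 0` for all
`b`, where `u` is a linear form. If some `L(uᵏ) ≠ 0`, all mollifications are polynomials of degree
at most `k`, hence so is their limit `σ`, a contradiction. Thus `L` kills powers of linear forms,
then their exponentials, whose span is dense by Stone–Weierstrass
(`eq_zero_of_forall_ridge_eq_zero`).

For (i) and (ii), approximate `f` by one network on each of finitely many `K i`, with coefficient 0
on the rest; the tail of `f` vanishes by dominated convergence. A single sequence converges for all
the topologies generating the strict one (`exists_seq_tope`).

For (iii), architopes contain the networks. If there is an architope `g` outside `NN_J`, the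
topology whose nonempty open sets are those containing `g` separates the two. On a connected
support, a nonzero constant on `K 0` extended by 0 is such a `g`, since networks are continuous. -/

theorem _root_.Polynomial.exists_derivative_eq (P : ℝ[X]) :
    ∃ Q : ℝ[X], Q.derivative = P ∧ Q.natDegree ≤ P.natDegree + 1 := by
  refine ⟨∑ i ∈ Finset.range (P.natDegree + 1),
    Polynomial.C (P.coeff i / (i + 1)) * Polynomial.X ^ (i + 1), ?_, ?_⟩
  · conv_rhs => rw [P.as_sum_range_C_mul_X_pow]
    rw [Polynomial.derivative_sum]
    refine Finset.sum_congr rfl fun i _ => ?_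
    rw [Polynomial.derivative_C_mul_X_pow]
    congr 2
    push_cast
    field_simp
  · refine Polynomial.natDegree_sum_le_of_forall_le _ _ fun i hi => ?_
    refine (Polynomial.natDegree_C_mul_X_pow_le _ _).trans ?_
    simpa [Nat.lt_succ_iff] using Finset.mem_range.1 hi

/-- The degree bound is not sharp; it need only be the same for all mollifications, so that the
limit stays in a finite-dimensional space. -/
theorem exists_polynomial_of_iteratedDeriv_eq_zero (k : ℕ) :
    ∀ {f : ℝ → ℝ}, ContDiff ℝ ∞ f → (∀ x, iteratedDeriv k f x = 0) →
      ∃ P : ℝ[X], P.natDegree ≤ k ∧ ∀ x, f x = P.eval x := by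
  induction k with
  | zero => exact fun _ h => ⟨0, by simp, fun x => by simpa using h x⟩
  | succ k ih =>
    intro f hf h
    have hf' : ContDiff ℝ ∞ (deriv f) := (contDiff_infty_iff_deriv.1 hf).2
    obtain ⟨P, hP, hfP⟩ := ih hf' fun x => by rw [← h x, iteratedDeriv_succ']
    obtain ⟨Q, hQ, hQd⟩ := P.exists_derivative_eq
    have hfd : Differentiable ℝ f := hf.differentiable (by simp)
    have hc : ∀ x, f x - Q.eval x = f 0 - Q.eval 0 := by
      intro x
      refine is_const_of_deriv_eq_zero (f := fun x => f x - Q.eval x)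
        (hfd.sub Q.differentiable) (fun y => ?_) x 0
      rw [deriv_fun_sub (hfd y) Q.differentiableAt, hfP, Polynomial.deriv, hQ, sub_self]
    refine ⟨Q + Polynomial.C (f 0 - Q.eval 0), ?_, fun x => ?_⟩
    · refine (Polynomial.natDegree_add_le _ _).trans (max_le (hQd.trans (by omega)) (by simp))
    · rw [Polynomial.eval_add, Polynomial.eval_C, ← hc x]; ring

/-- Pointwise limits of polynomial functions of bounded degree are polynomial. -/
theorem exists_polynomial_of_tendsto {k : ℕ} {f : ℕ → ℝ → ℝ} {g : ℝ → ℝ}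
    (hf : ∀ n, ∃ P : ℝ[X], P.natDegree ≤ k ∧ ∀ x, f n x = P.eval x)
    (h : ∀ x, Tendsto (fun n => f n x) atTop (𝓝 (g x))) :
    ∃ P : ℝ[X], ∀ x, g x = P.eval x := by
  let ev : ℝ[X] →ₗ[ℝ] (ℝ → ℝ) := LinearMap.pi fun x => Polynomial.leval x
  let S : Submodule ℝ (ℝ → ℝ) := (Polynomial.degreeLT ℝ (k + 1)).map ev
  have : FiniteDimensional ℝ (Polynomial.degreeLT ℝ (k + 1)) :=
    Module.Finite.equiv (Polynomial.degreeLTEquiv ℝ (k + 1)).symm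
  have : FiniteDimensional ℝ S := by infer_instance
  -- A finite-dimensional subspace is closed even for pointwise convergence.
  have hS : IsClosed (S : Set (ℝ → ℝ)) := S.closed_of_finiteDimensional
  have hg : g ∈ S := by
    refine hS.mem_of_tendsto (tendsto_pi_nhds.2 h) (Eventually.of_forall fun n => ?_)
    obtain ⟨P, hP, hPe⟩ := hf n
    refine ⟨P, ?_, funext fun x => (hPe x).symm⟩
    rw [SetLike.mem_coe, Polynomial.mem_degreeLT]
    exact Polynomial.degree_le_natDegree.trans_lt (by exact_mod_cast Nat.lt_succ_of_le hP)
  obtain ⟨P, -, hP⟩ := hg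
  exact ⟨P, fun x => by rw [← hP]; rfl⟩

section Ridge

variable {X : Type*} [TopologicalSpace X]

/-- The function `x ↦ σ (a u(x) + b)`. -/
def ridge (σ : C(ℝ, ℝ)) (u : C(X, ℝ)) (a b : ℝ) : C(X, ℝ) :=
  σ.comp (a • u + ContinuousMap.const X b)

@[simp]
theorem ridge_apply (σ : C(ℝ, ℝ)) (u : C(X, ℝ)) (a b : ℝ) (x : X) :
    ridge σ u a b x = σ (a * u x + b) := rfl

theorem continuous_const_map : Continuous (ContinuousMap.const X : ℝ → C(X, ℝ)) :=
  ContinuousMap.continuous_const'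

variable [CompactSpace X]

theorem continuous_ridge (σ : C(ℝ, ℝ)) (u : C(X, ℝ)) :
    Continuous fun q : ℝ × ℝ => ridge σ u q.1 q.2 :=
  (ContinuousMap.continuous_postcomp σ).comp
    ((continuous_fst.smul continuous_const).add (continuous_const_map.comp continuous_snd))

/-- The derivative is in the sup norm, so that `L` can be applied to it. Pointwise differentiation
does not suffice: the curve is written as the integral of a continuous `C(X, ℝ)`-valued curve. -/
theorem hasDerivAt_ridge {τ τ' : C(ℝ, ℝ)} (hτ : ∀ x, HasDerivAt τ (τ' x) x) (u v : C(X, ℝ))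
    (a b : ℝ) :
    HasDerivAt (fun a => v * ridge τ u a b) (v * u * ridge τ' u a b) a := by
  have hc : Continuous fun a => v * u * ridge τ' u a b :=
    continuous_const.mul
      ((continuous_ridge τ' u).comp (continuous_id.prodMk continuous_const))
  have key : (fun a => v * ridge τ u a b) =
      fun a => v * ridge τ u 0 b + ∫ s in (0 : ℝ)..a, v * u * ridge τ' u s b := by
    funext a
    ext x
    have h1 : (∫ s in (0 : ℝ)..a, v * u * ridge τ' u s b) x =
        ∫ s in (0 : ℝ)..a, v x * u x * τ' (s * u x + b) :=
      ((ContinuousMap.evalCLM ℝ x).intervalIntegral_comp_comm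
        (hc.intervalIntegrable 0 a)).symm
    have h2 : ∫ s in (0 : ℝ)..a, v x * u x * τ' (s * u x + b) =
        v x * τ (a * u x + b) - v x * τ (0 * u x + b) := by
      refine intervalIntegral.integral_eq_sub_of_hasDerivAt
        (f := fun s => v x * τ (s * u x + b)) (fun s _ => ?_) ?_
      · have h3 : HasDerivAt (fun s => s * u x + b) (u x) s := by
          simpa using ((hasDerivAt_id s).mul_const (u x)).add_const b
        have h4 := ((hτ (s * u x + b)).comp s h3).const_mul (v x)
        refine h4.congr_deriv ?_
        ring
      · exact (by fun_prop : Continuous fun s => v x * u x * τ' (s * u x + b)).intervalIntegrable _ _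
    rw [ContinuousMap.add_apply, h1, h2]
    simp
  rw [key]
  exact (intervalIntegral.integral_hasDerivAt_right (hc.intervalIntegrable _ _)
    (hc.stronglyMeasurableAtFilter _ _) hc.continuousAt).const_add _

/-- Each derivative in `a` brings out one factor `u` and one derivative of `τ`; at `a = 0` the ridge
function is the constant `τ⁽ᵏ⁾(b)`. -/
theorem apply_pow_mul_iteratedDeriv_eq_zero (L : C(X, ℝ) →L[ℝ] ℝ) (u : C(X, ℝ)) {τ : ℝ → ℝ}
    (hτ : ContDiff ℝ ∞ τ) (b : ℝ)
    (h : ∀ a, L (ridge ⟨τ, hτ.continuous⟩ u a b) = 0) (k : ℕ) :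
    iteratedDeriv k τ b * L (u ^ k) = 0 := by
  have hτk : ∀ k, Continuous (iteratedDeriv k τ) := fun k =>
    hτ.continuous_iteratedDeriv k (by exact_mod_cast le_top)
  have key : ∀ k a, L (u ^ k * ridge ⟨_, hτk k⟩ u a b) = 0 := by
    intro k
    induction k with
    | zero =>
      intro a
      rw [← h a]
      congr 1
      ext x
      simp
    | succ k ih =>
      intro a
      have hd : ∀ x, HasDerivAt (iteratedDeriv k τ) (iteratedDeriv (k + 1) τ x) x := by
        intro x
        rw [iteratedDeriv_succ]
        exact (hτ.differentiable_iteratedDeriv k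
          (by exact_mod_cast ENat.natCast_lt_top k) x).hasDerivAt
      have h1 := L.hasFDerivAt.comp_hasDerivAt a
        (hasDerivAt_ridge (τ := ⟨_, hτk k⟩) (τ' := ⟨_, hτk (k + 1)⟩) hd u (u ^ k) a b)
      have h2 : (L ∘ fun a => u ^ k * ridge ⟨_, hτk k⟩ u a b) = fun _ => 0 := funext ih
      rw [h2] at h1
      rw [pow_succ]
      exact h1.unique (hasDerivAt_const a 0)
  have h0 := key k 0
  have h1 : u ^ k * ridge ⟨_, hτk k⟩ u 0 b = iteratedDeriv k τ b • u ^ k := by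
    ext x
    simp [mul_comm]
  rwa [h1, map_smul, smul_eq_mul] at h0

/-- A ridge function of `φ ⋆ σ` is a Bochner integral in `C(X, ℝ)` of ridge functions of `σ` with
shifted `b`, and `L` passes under the integral. -/
theorem apply_ridge_convolution_eq_zero (L : C(X, ℝ) →L[ℝ] ℝ) (u : C(X, ℝ)) (σ : C(ℝ, ℝ))
    (h : ∀ a b, L (ridge σ u a b) = 0) {φ : ℝ → ℝ} (hφ : Continuous φ) (hφc : HasCompactSupport φ)
    (hc : Continuous (φ ⋆[ContinuousLinearMap.lsmul ℝ ℝ, volume] σ)) (a b : ℝ) :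
    L (ridge ⟨φ ⋆[ContinuousLinearMap.lsmul ℝ ℝ, volume] σ, hc⟩ u a b) = 0 := by
  have hF : Continuous fun t => φ t • ridge σ u a (b - t) :=
    hφ.smul ((continuous_ridge σ u).comp (continuous_const.prodMk (continuous_const.sub continuous_id)))
  have hI : Integrable (fun t => φ t • ridge σ u a (b - t)) :=
    hF.integrable_of_hasCompactSupport hφc.smul_right
  have h1 : ridge ⟨φ ⋆[ContinuousLinearMap.lsmul ℝ ℝ, volume] σ, hc⟩ u a b =
      ∫ t, φ t • ridge σ u a (b - t) := by
    ext x
    have h2 : (∫ t, φ t • ridge σ u a (b - t)) x = ∫ t, φ t * σ (a * u x + (b - t)) :=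
      ((ContinuousMap.evalCLM ℝ x).integral_comp_comm hI).symm
    rw [h2]
    simp only [ridge_apply, ContinuousMap.coe_mk, convolution_def,
      ContinuousLinearMap.lsmul_apply, smul_eq_mul, add_sub_assoc]
  rw [h1, ← L.integral_comp_comm hI]
  simp [h]

theorem apply_pow_eq_zero (L : C(X, ℝ) →L[ℝ] ℝ) (u : C(X, ℝ)) (σ : C(ℝ, ℝ))
    (hσ : ¬ ∃ P : ℝ[X], ∀ x, σ x = P.eval x) (h : ∀ a b, L (ridge σ u a b) = 0) (k : ℕ) :
    L (u ^ k) = 0 := by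
  by_contra hk
  apply hσ
  -- Bumps shrinking to 0, so that the mollifications converge pointwise to `σ`.
  let φ : ℕ → ContDiffBump (0 : ℝ) := fun n =>
    ⟨1 / (n + 1 : ℝ) / 2, 1 / (n + 1 : ℝ), by positivity, half_lt_self (by positivity)⟩
  have hφ : Tendsto (fun n => (φ n).rOut) atTop (𝓝 0) := tendsto_one_div_add_atTop_nhds_zero_nat
  have hs : ∀ n, ContDiff ℝ ∞
      ((φ n).normed volume ⋆[ContinuousLinearMap.lsmul ℝ ℝ, volume] σ) := fun n =>
    (φ n).hasCompactSupport_normed.contDiff_convolution_left _ (φ n).contDiff_normed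
      σ.continuous.locallyIntegrable
  refine exists_polynomial_of_tendsto (k := k) (fun n => ?_)
    (ContDiffBump.convolution_tendsto_right_of_continuous (μ := volume) hφ σ.continuous)
  refine exists_polynomial_of_iteratedDeriv_eq_zero k (hs n) fun b => ?_
  have := apply_pow_mul_iteratedDeriv_eq_zero L u (hs n) b (fun a =>
    apply_ridge_convolution_eq_zero L u σ h ((φ n).contDiff_normed (n := 0)).continuous
      (φ n).hasCompactSupport_normed (hs n).continuous a b) k
  exact (mul_eq_zero.1 this).resolve_right hk

/-- The exponential series converges in the Banach algebra `C(X, ℝ)`, and `L` is continuous. -/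
theorem apply_exp_eq_zero (L : C(X, ℝ) →L[ℝ] ℝ) (u : C(X, ℝ)) (h : ∀ k, L (u ^ k) = 0) :
    L (ContinuousMap.comp ⟨Real.exp, Real.continuous_exp⟩ u) = 0 := by
  have h1 : HasSum (fun n : ℕ => ((n.factorial : ℝ)⁻¹) • u ^ n) (NormedSpace.exp u) :=
    NormedSpace.exp_series_hasSum_exp' (𝕂 := ℝ) u
  have h2 : NormedSpace.exp u = ContinuousMap.comp ⟨Real.exp, Real.continuous_exp⟩ u := by
    ext x
    have h3 := (ContinuousMap.evalCLM ℝ x).hasSum h1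
    have h4 : HasSum (fun n : ℕ => ((n.factorial : ℝ)⁻¹) • (u x) ^ n) (NormedSpace.exp (u x)) :=
      NormedSpace.exp_series_hasSum_exp' (𝕂 := ℝ) (u x)
    rw [← Real.exp_eq_exp_ℝ] at h4
    exact h3.unique (by simpa [Function.comp_def] using h4)
  rw [← h2]
  have h5 := L.hasSum h1
  refine h5.unique ?_
  simp [h, hasSum_zero]

end Ridge

end Polynomial

/-! ### Density of the span of ridge functions on a compact set. -/

section Shallow

/-- The linear form `x ↦ ⟪w, x⟫` restricted to `C`. -/
noncomputable def linearOn {d : ℕ} (C : Set (Eu d)) (w : Eu d) : C(C, ℝ) :=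
  ⟨fun x => inner ℝ w (x : Eu d), by fun_prop⟩

/-- The subalgebra of `C(C, ℝ)` spanned by the exponentials of linear forms. -/
noncomputable def expAlgebra {d : ℕ} (C : Set (Eu d)) : Subalgebra ℝ C(C, ℝ) :=
  Algebra.adjoin ℝ (range fun w : Eu d =>
    ContinuousMap.comp ⟨Real.exp, Real.continuous_exp⟩ (linearOn C w))

theorem expAlgebra_separatesPoints {d : ℕ} (C : Set (Eu d)) : (expAlgebra C).SeparatesPoints := by
  intro x y hxy
  -- The weight `x - y` separates `x` from `y`: equal values would force `‖x - y‖² = 0`.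
  refine ⟨_, ⟨_, Algebra.subset_adjoin ⟨(x : Eu d) - y, rfl⟩, rfl⟩, fun h => hxy ?_⟩
  have h1 : inner ℝ ((x : Eu d) - y) (x : Eu d) = inner ℝ ((x : Eu d) - y) (y : Eu d) :=
    Real.exp_injective h
  rw [← sub_eq_zero, ← inner_sub_right, inner_self_eq_zero, sub_eq_zero] at h1
  exact Subtype.ext h1

/-- Products of exponentials of linear forms are again such exponentials, so a linear functional
need only be tested on the generators. -/
theorem expAlgebra_toSubmodule {d : ℕ} (C : Set (Eu d)) :
    Subalgebra.toSubmodule (expAlgebra C) = Submodule.span ℝ (range fun w : Eu d =>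
      ContinuousMap.comp ⟨Real.exp, Real.continuous_exp⟩ (linearOn C w)) := by
  let M : Submonoid C(C, ℝ) :=
    { carrier := range fun w : Eu d =>
        ContinuousMap.comp ⟨Real.exp, Real.continuous_exp⟩ (linearOn C w)
      one_mem' := ⟨0, by ext x; simp [linearOn]⟩
      mul_mem' := by
        rintro _ _ ⟨v, rfl⟩ ⟨w, rfl⟩
        exact ⟨v + w, by ext x; simp [linearOn, inner_add_left, Real.exp_add]⟩ }
  rw [expAlgebra, Algebra.adjoin_eq_span]
  exact congrArg (Submodule.span ℝ) (congrArg SetLike.coe (Submonoid.closure_eq M))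

variable {d : ℕ} {C : Set (Eu d)} [CompactSpace C]

theorem eq_zero_of_forall_ridge_eq_zero (σ : C(ℝ, ℝ))
    (hσ : ¬ ∃ P : ℝ[X], ∀ x, σ x = P.eval x) (L : C(C, ℝ) →L[ℝ] ℝ)
    (h : ∀ w b, L (ridge σ (linearOn C w) 1 b) = 0) : L = 0 := by
  have hdense : Dense (expAlgebra C : Set C(C, ℝ)) := by
    have := ContinuousMap.subalgebra_topologicalClosure_eq_top_of_separatesPoints _
      (expAlgebra_separatesPoints C)
    rw [dense_iff_closure_eq, ← Subalgebra.topologicalClosure_coe, this]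
    rfl
  have hle : Subalgebra.toSubmodule (expAlgebra C) ≤ LinearMap.ker (L : C(C, ℝ) →ₗ[ℝ] ℝ) := by
    rw [expAlgebra_toSubmodule, Submodule.span_le]
    rintro _ ⟨w, rfl⟩
    refine apply_exp_eq_zero L _ (apply_pow_eq_zero L _ σ hσ fun a b => ?_)
    -- The slope is absorbed into the weight.
    rw [← h (a • w) b]
    congr 1
    ext x
    simp [linearOn, inner_smul_left]
  have : (L : C(C, ℝ) → ℝ) = (0 : C(C, ℝ) →L[ℝ] ℝ) :=
    Continuous.ext_on hdense L.continuous (0 : C(C, ℝ) →L[ℝ] ℝ).continuous fun f hf => hle hf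
  exact DFunLike.coe_injective this

/-- A subspace annihilated only by the zero functional is dense. -/
theorem _root_.Submodule.dense_of_forall_dual {E : Type*} [NormedAddCommGroup E] [NormedSpace ℝ E]
    (V : Submodule ℝ E) (h : ∀ L : E →L[ℝ] ℝ, (∀ x ∈ V, L x = 0) → L = 0) :
    Dense (V : Set E) := by
  rw [Submodule.dense_iff_topologicalClosure_eq_top, eq_top_iff]
  intro x _
  by_contra hx
  have : IsClosed (V.topologicalClosure : Set E) := V.isClosed_topologicalClosure
  obtain ⟨f, s, hf, hfx⟩ := geometric_hahn_banach_closed_point V.topologicalClosure.convex this hx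
  have h0 : ∀ y ∈ V, f y = 0 := by
    intro y hy
    by_contra hne
    -- Rescaling `y` gives `f` the value `s + 1`, beyond its bound `s` on the subspace.
    have h1 := hf _ (V.topologicalClosure.smul_mem ((s + 1) / f y) (V.le_topologicalClosure hy))
    rw [map_smul, smul_eq_mul, div_mul_cancel₀ _ hne] at h1
    linarith
  have h1 := hf 0 V.topologicalClosure.zero_mem
  rw [h f h0] at h1 hfx
  simp at h1 hfx
  linarith

theorem dense_span_ridge (σ : C(ℝ, ℝ)) (hσ : ¬ ∃ P : ℝ[X], ∀ x, σ x = P.eval x) :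
    Dense (Submodule.span ℝ (range fun q : Eu d × ℝ => ridge σ (linearOn C q.1) 1 q.2) :
      Set C(C, ℝ)) :=
  Submodule.dense_of_forall_dual _ fun L hL => eq_zero_of_forall_ridge_eq_zero σ hσ L
    fun w b => hL _ (Submodule.subset_span ⟨(w, b), rfl⟩)

end Shallow

/-! ### Universal approximation by networks of depth one. -/

section Network

variable {d D : ℕ}

/-- The linear combinations of the vector-valued ridge functions `x ↦ σ(⟪w, x⟫ + b) v`. -/
noncomputable def shallow (σ : ℝ → ℝ) (d D : ℕ) : Submodule ℝ (Eu d → Eu D) :=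
  Submodule.span ℝ (range fun (q : Eu d × ℝ × Eu D) (x : Eu d) =>
    σ (inner ℝ q.1 x + q.2.1) • q.2.2)

theorem isNetwork_sum (σ : ℝ → ℝ) {m : ℕ} (w : Fin m → Eu d) (b : Fin m → ℝ) (v : Fin m → Eu D) :
    IsNetwork σ d D 1 fun x => ∑ i, σ (inner ℝ (w i) x + b i) • v i := by
  let A : Eu d →ₗ[ℝ] Eu m := (WithLp.linearEquiv 2 ℝ (Fin m → ℝ)).symm.toLinearMap ∘ₗ
    LinearMap.pi fun i => (innerSL ℝ (w i) : Eu d →L[ℝ] ℝ).toLinearMap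
  let W : Eu m →ₗ[ℝ] Eu D := ∑ i, (EuclideanSpace.proj i : Eu m →L[ℝ] ℝ).toLinearMap.smulRight (v i)
  refine ⟨m, _, W.toAffineMap, IsHidden.layer IsHidden.input
    (A.toAffineMap + AffineMap.const ℝ (Eu d) (WithLp.toLp 2 b : Eu m)), ?_⟩
  funext x
  simp [W, A, act, LinearMap.sum_apply]

theorem isNetwork_of_mem_shallow {σ : ℝ → ℝ} {f : Eu d → Eu D} (hf : f ∈ shallow σ d D) :
    IsNetwork σ d D 1 f := by
  obtain ⟨c, rfl⟩ := Finsupp.mem_span_range_iff_exists_finsupp.1 hf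
  let e := c.support.equivFin.symm
  -- The coefficients of the combination go into the output vectors.
  convert isNetwork_sum σ (fun i => (e i).1.1) (fun i => (e i).1.2.1)
    (fun i => c (e i).1 • (e i).1.2.2) using 1
  funext x
  rw [e.sum_comp fun q => σ (inner ℝ q.1.1 x + q.1.2.1) • c q.1 • q.1.2.2,
    Finset.sum_coe_sort c.support fun q => σ (inner ℝ q.1 x + q.2.1) • c q • q.2.2,
    Finsupp.sum, Finset.sum_apply]
  exact Finset.sum_congr rfl fun q _ => by
    rw [Pi.smul_apply, smul_comm]

theorem exists_shallow_scalar {σ : ℝ → ℝ} (hσ : Continuous σ)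
    (hpoly : ¬ ∃ P : ℝ[X], ∀ x, σ x = P.eval x) {C : Set (Eu d)} (hC : IsCompact C)
    {f : Eu d → ℝ} (hf : Continuous f) (v : Eu D) {ε : ℝ} (hε : 0 < ε) :
    ∃ h ∈ shallow σ d D, ∀ x ∈ C, ‖f x • v - h x‖ < ε := by
  have := isCompact_iff_compactSpace.1 hC
  -- The `+ 1` keeps the divisor positive when `v = 0`.
  have hv : 0 < ‖v‖ + 1 := by positivity
  obtain ⟨s, hs, hfs⟩ := Metric.dense_iff.1 (dense_span_ridge (C := C) ⟨σ, hσ⟩ hpoly)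
    ⟨fun x => f x, by fun_prop⟩ (ε / (‖v‖ + 1)) (div_pos hε hv)
  have key : ∀ s ∈ Submodule.span ℝ (range fun q : Eu d × ℝ =>
      ridge (⟨σ, hσ⟩ : C(ℝ, ℝ)) (linearOn C q.1) 1 q.2),
      ∃ h ∈ shallow σ d D, ∀ x : C, h x = s x • v := by
    intro s hs
    induction hs using Submodule.span_induction with
    | mem s hs =>
      obtain ⟨⟨w, b⟩, rfl⟩ := hs
      exact ⟨_, Submodule.subset_span ⟨(w, b, v), rfl⟩, fun x => by simp [linearOn]⟩
    | zero => exact ⟨0, Submodule.zero_mem _, fun x => by simp⟩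
    | add s t _ _ hs ht =>
      obtain ⟨h, hh, hhs⟩ := hs
      obtain ⟨k, hk, hkt⟩ := ht
      exact ⟨h + k, Submodule.add_mem _ hh hk, fun x => by simp [hhs, hkt, add_smul]⟩
    | smul c s _ hs =>
      obtain ⟨h, hh, hhs⟩ := hs
      exact ⟨c • h, Submodule.smul_mem _ c hh, fun x => by simp [hhs, mul_smul]⟩
  obtain ⟨h, hh, hhs⟩ := key s hfs
  refine ⟨h, hh, fun x hx => ?_⟩
  have h1 : dist (s ⟨x, hx⟩) (f x) < ε / (‖v‖ + 1) :=
    (ContinuousMap.dist_apply_le_dist (f := s) ⟨x, hx⟩).trans_lt hs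
  rw [hhs ⟨x, hx⟩, ← sub_smul, norm_smul, ← dist_eq_norm, dist_comm]
  calc dist (s ⟨x, hx⟩) (f x) * ‖v‖ ≤ dist (s ⟨x, hx⟩) (f x) * (‖v‖ + 1) := by gcongr; linarith
    _ < ε := (lt_div_iff₀ hv).1 h1

/-- Universal approximation by networks of depth one, uniformly on compact sets. -/
theorem exists_isNetwork_approx {σ : ℝ → ℝ} (hσ : Continuous σ)
    (hpoly : ¬ ∃ P : ℝ[X], ∀ x, σ x = P.eval x) {C : Set (Eu d)} (hC : IsCompact C)
    {f : Eu d → Eu D} (hf : Continuous f) {ε : ℝ} (hε : 0 < ε) :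
    ∃ h, IsNetwork σ d D 1 h ∧ ∀ x ∈ C, ‖f x - h x‖ < ε := by
  have hD : (0 : ℝ) < D + 1 := by positivity
  choose h hh hfh using fun i : Fin D => exists_shallow_scalar hσ hpoly hC
    (f := fun x => f x i) (by fun_prop) (EuclideanSpace.single i (1 : ℝ)) (div_pos hε hD)
  refine ⟨∑ i, h i, isNetwork_of_mem_shallow (Submodule.sum_mem _ fun i _ => hh i), fun x hx => ?_⟩
  have h1 : f x = ∑ i, f x i • EuclideanSpace.single i (1 : ℝ) := by
    ext j
    simp [Finset.sum_apply, Pi.single_apply]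
  rw [h1, Finset.sum_apply, ← Finset.sum_sub_distrib]
  calc _ ≤ ∑ i, ‖f x i • EuclideanSpace.single i (1 : ℝ) - h i x‖ := norm_sum_le _ _
    _ ≤ ∑ _i : Fin D, ε / (D + 1) := Finset.sum_le_sum fun i _ => (hfh i x hx).le
    _ = D * (ε / (D + 1)) := by simp
    _ < (D + 1) * (ε / (D + 1)) := by
      have := div_pos hε hD
      nlinarith
    _ = ε := by field_simp

theorem IsHidden.continuous {σ : ℝ → ℝ} (hσ : Continuous σ) {j m : ℕ} {g : Eu d → Eu m}
    (h : IsHidden σ d j m g) : Continuous g := by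
  induction h with
  | input => exact continuous_id
  | layer hg W ih =>
    have hW := W.continuous_of_finiteDimensional
    unfold act
    fun_prop

theorem IsNetwork.continuous {σ : ℝ → ℝ} (hσ : Continuous σ) {j : ℕ} {f : Eu d → Eu D}
    (h : IsNetwork σ d D j f) : Continuous f := by
  obtain ⟨m, g, W, hg, rfl⟩ := h
  exact W.continuous_of_finiteDimensional.comp (hg.continuous hσ)

/-- Approximation in `L^p` of a compact set. -/
theorem exists_isNetwork_eLpNorm_sub_le {σ : ℝ → ℝ} (hσ : Continuous σ)
    (hpoly : ¬ ∃ P : ℝ[X], ∀ x, σ x = P.eval x) {p : ℝ≥0∞} (hp1 : 1 ≤ p) (hp : p ≠ ∞)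
    {μ : Measure (Eu d)} {C : Set (Eu d)} (hC : IsCompact C) (hμC : μ C < ∞)
    {f : Eu d → Eu D} (hf : MemLp f p (μ.restrict C)) {ε : ℝ≥0∞} (hε : ε ≠ 0) :
    ∃ h, IsNetwork σ d D 1 h ∧ eLpNorm (f - h) p (μ.restrict C) ≤ ε := by
  have : IsFiniteMeasure (μ.restrict C) := ⟨by simpa using hμC⟩
  have hε2 : ε / 2 ≠ 0 := (ENNReal.half_pos hε).ne'
  obtain ⟨g, hfg, -⟩ := hf.exists_boundedContinuous_eLpNorm_sub_le hp hε2
  set c : ℝ≥0∞ := (μ.restrict C) univ ^ p.toReal⁻¹ with hc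
  have hct : c ≠ ∞ := ENNReal.rpow_ne_top_of_nonneg (by positivity) (measure_ne_top _ _)
  -- A uniform error `δ` on `C` costs at most `μ(C)^(1/p) δ` in `L^p`.
  obtain ⟨δ, hδ, hδε⟩ : ∃ δ : ℝ, 0 < δ ∧ c * ENNReal.ofReal δ ≤ ε / 2 := by
    obtain ⟨δ, hδ, h⟩ := ENNReal.exists_nnreal_pos_mul_lt hct hε2
    refine ⟨δ, hδ, ?_⟩
    rw [ENNReal.ofReal_coe_nnreal, mul_comm]
    exact h.le
  obtain ⟨h, hh, hgh⟩ := exists_isNetwork_approx hσ hpoly hC g.continuous hδ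
  refine ⟨h, hh, ?_⟩
  have h1 : eLpNorm (⇑g - h) p (μ.restrict C) ≤ ε / 2 := by
    refine (eLpNorm_le_of_ae_bound (C := δ) ?_).trans hδε
    filter_upwards [ae_restrict_mem hC.measurableSet] with x hx using (hgh x hx).le
  have h2 : f - h = (f - ⇑g) + (⇑g - h) := by abel
  rw [h2]
  calc _ ≤ _ := eLpNorm_add_le (hf.1.sub g.continuous.aestronglyMeasurable)
        (g.continuous.aestronglyMeasurable.sub (hh.continuous hσ).aestronglyMeasurable) hp1
    _ ≤ ε / 2 + ε / 2 := add_le_add hfg h1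
    _ = ε := ENNReal.add_halves ε

end Network

/-! ### Density of architopes in the strict topology and in `L^p`. -/

section Strict

variable {d D : ℕ} {p : ℝ≥0∞} {μ : Measure (Eu d)} {K : ℕ → Set (Eu d)}

theorem IsPartition.isCompact_iUnion (hK : IsPartition μ K) (n : ℕ) :
    IsCompact (⋃ i : Fin n, K i) :=
  _root_.isCompact_iUnion fun i => hK.isCompact i

theorem IsPartition.indicator_iUnion_ae_eq (hK : IsPartition μ K) (n : ℕ) (f : Eu d → Eu D) :
    (⋃ i : Fin n, K i).indicator f =ᵐ[μ] fun x => ∑ i : Fin n, (K i).indicator f x := by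
  have h : ∀ᵐ x ∂μ, ∀ i j, i ≠ j → x ∉ K i ∩ K j := by
    rw [ae_all_iff]; intro i
    rw [ae_all_iff]; intro j
    by_cases hij : i = j
    · exact Eventually.of_forall fun x h => absurd hij h
    · filter_upwards [measure_eq_zero_iff_ae_notMem.1 (hK.inter_null i j hij)] with x hx _ using hx
  filter_upwards [h] with x hx
  by_cases hxs : x ∈ ⋃ i : Fin n, K i
  · obtain ⟨i, hi⟩ := mem_iUnion.1 hxs
    rw [indicator_of_mem hxs, Finset.sum_eq_single i, indicator_of_mem hi]
    · intro j _ hji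
      exact indicator_of_notMem (fun hj => hx i j (fun h => hji (Fin.ext h.symm)) ⟨hi, hj⟩) _
    · simp
  · rw [indicator_of_notMem hxs]
    refine (Finset.sum_eq_zero fun i _ => indicator_of_notMem (fun hi => hxs ?_) _).symm
    exact mem_iUnion.2 ⟨i, hi⟩

/-- The union of open sets defining the support may be uncountable; by the Lindelöf property a
countable subfamily has the same union. -/
theorem ae_eq_zero_of_essSupport_subset {f : Eu d → Eu D} {S : Set (Eu d)}
    (h : essSupport μ f ⊆ S) : ∀ᵐ x ∂μ, x ∉ S → f x = 0 := by
  obtain ⟨T, hTc, hTs, hT⟩ := TopologicalSpace.isOpen_sUnion_countable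
    {U : Set (Eu d) | IsOpen U ∧ ∀ᵐ x ∂μ, x ∈ U → ‖f x‖ = 0} fun U hU => hU.1
  have hall : ∀ᵐ x ∂μ, ∀ U ∈ T, x ∈ U → ‖f x‖ = 0 :=
    (ae_ball_iff hTc).2 fun U hU => (hTs hU).2
  filter_upwards [hall] with x hx hxS
  have h1 : x ∈ ⋃₀ T := by
    rw [hT]
    by_contra hc
    exact hxS (h hc)
  obtain ⟨U, hU, hxU⟩ := h1
  exact norm_eq_zero.1 (hx U hU hxU)

theorem essSupport_subset {f : Eu d → Eu D} {S : Set (Eu d)} (hS : IsClosed S)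
    (h : ∀ᵐ x ∂μ, x ∉ S → f x = 0) : essSupport μ f ⊆ S := by
  rw [essSupport, compl_subset_comm]
  refine subset_sUnion_of_mem ⟨hS.isOpen_compl, ?_⟩
  filter_upwards [h] with x hx hxS
  rw [hx hxS, norm_zero]

theorem _root_.Continuous.memLp_indicator_of_isCompact {f : Eu d → Eu D} (hf : Continuous f)
    {C : Set (Eu d)} (hC : IsCompact C) (hμC : μ C < ∞) : MemLp (C.indicator f) p μ := by
  rw [memLp_indicator_iff_restrict hC.measurableSet]
  have : IsFiniteMeasure (μ.restrict C) := ⟨by simpa using hμC⟩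
  obtain ⟨M, hM⟩ := hC.exists_bound_of_continuousOn hf.continuousOn
  exact MemLp.of_bound hf.aestronglyMeasurable M
    ((ae_restrict_mem hC.measurableSet).mono fun x hx => hM x hx)

theorem ofLp_fn (f : Lp (Eu D) p μ) : (ofLp f).fn = f := rfl

theorem LpLoc.fn_aestronglyMeasurable (f : LpLoc d D p μ) : AEStronglyMeasurable f.fn μ :=
  f.1.aestronglyMeasurable

/-- On finitely many sets of the partition, an element of `L^p_{μ,loc}` is approximated by an
architope supported in these sets. -/
theorem exists_tope_approx [Fact (1 ≤ p)] (hp : p ≠ ∞) (hK : IsPartition μ K)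
    (hKμ : ∀ n, μ (K n) < ∞) {σ : ℝ → ℝ} (hσ : Continuous σ)
    (hpoly : ¬ ∃ P : ℝ[X], ∀ x, σ x = P.eval x) {J : ℕ} (hJ : 1 ≤ J) (f : LpLoc d D p μ)
    {n : ℕ} (hn : 1 ≤ n) {ε : ℝ≥0∞} (hε : ε ≠ 0) :
    ∃ G : Lp (Eu D) p μ, ofLp G ∈ tope p μ K (NN σ d D J) ∧
      (∀ᵐ x ∂μ, x ∉ ⋃ i : Fin n, K i → G x = 0) ∧
      eLpNorm ((⋃ i : Fin n, K i).indicator f.fn - ⇑G) p μ ≤ ε := by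
  have hn0 : (n : ℝ≥0∞) ≠ 0 := by exact_mod_cast (by omega : n ≠ 0)
  choose h hh hfh using fun i : Fin n => exists_isNetwork_eLpNorm_sub_le (D := D) hσ hpoly
    (Fact.out : 1 ≤ p) hp (hK.isCompact i) (hKμ i) (f.2 (K i) (hK.isCompact i))
    (ENNReal.div_ne_zero.2 ⟨hε, ENNReal.natCast_ne_top n⟩)
  have hmem : MemLp (fun x => ∑ i : Fin n, (K i).indicator (h i) x) p μ :=
    memLp_finsetSum _ fun i _ =>
      ((hh i).continuous hσ).memLp_indicator_of_isCompact (hK.isCompact i) (hKμ i)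
  -- Coefficient 1 on each set and 0 outside; `n ≥ 1` makes some coefficient nonzero.
  refine ⟨hmem.toLp, ⟨n, fun _ => 1, h, 0, h ⟨0, hn⟩, hn, fun i => ⟨1, le_rfl, hJ, hh i⟩,
    ⟨1, le_rfl, hJ, hh _⟩, Or.inr ⟨⟨0, hn⟩, one_ne_zero⟩, ?_⟩, ?_, ?_⟩
  · filter_upwards [hmem.coeFn_toLp] with x hx
    rw [ofLp_fn, hx]
    simp [architopeFn]
  · filter_upwards [hmem.coeFn_toLp] with x hx hxS
    rw [hx]
    exact Finset.sum_eq_zero fun i _ => indicator_of_notMem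
      (fun hi => hxS (mem_iUnion.2 ⟨i, hi⟩)) _
  · have h1 : (⋃ i : Fin n, K i).indicator f.fn - ⇑hmem.toLp =ᵐ[μ]
        ∑ i : Fin n, (K i).indicator (f.fn - h i) := by
      filter_upwards [hmem.coeFn_toLp, hK.indicator_iUnion_ae_eq n f.fn] with x hx hx'
      rw [Pi.sub_apply, hx, hx', ← Finset.sum_sub_distrib, Finset.sum_apply]
      refine Finset.sum_congr rfl fun i _ => ?_
      rw [indicator_sub']
      rfl
    rw [eLpNorm_congr_ae h1]
    calc _ ≤ ∑ i : Fin n, eLpNorm ((K i).indicator (f.fn - h i)) p μ :=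
          eLpNorm_sum_le (fun i _ => (f.fn_aestronglyMeasurable.sub
            ((hh i).continuous hσ).aestronglyMeasurable).indicator (hK.isCompact i).measurableSet)
            Fact.out
      _ ≤ ∑ _i : Fin n, ε / n := by
          refine Finset.sum_le_sum fun i _ => ?_
          rw [eLpNorm_indicator_eq_eLpNorm_restrict (hK.isCompact i).measurableSet]
          exact hfh i
      _ = n * (ε / n) := by simp
      _ = ε := ENNReal.mul_div_cancel hn0 (ENNReal.natCast_ne_top n)

theorem tendsto_eLpNorm_of_dominated {α E : Type*} [MeasurableSpace α] [NormedAddCommGroup E]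
    {ν : Measure α} (hp1 : 1 ≤ p) (hp : p ≠ ∞) {f : α → E} (hf : MemLp f p ν) {s : ℕ → Set α}
    (hs : ∀ n, MeasurableSet (s n)) (h : ∀ᵐ x ∂ν, ∀ᶠ n in atTop, x ∉ s n) :
    Tendsto (fun n => eLpNorm ((s n).indicator f) p ν) atTop (𝓝 0) := by
  have hp0 : p ≠ 0 := (zero_lt_one.trans_le hp1).ne'
  have hp0' : 0 < p.toReal := ENNReal.toReal_pos hp0 hp
  have h1 : Tendsto (fun n => ∫⁻ x, ‖(s n).indicator f x‖ₑ ^ p.toReal ∂ν) atTop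
      (𝓝 (∫⁻ _, 0 ∂ν)) := by
    refine tendsto_lintegral_of_dominated_convergence' (fun x => ‖f x‖ₑ ^ p.toReal)
      (fun n => (hf.1.indicator (hs n)).enorm.pow_const _)
      (fun n => Eventually.of_forall fun x => ?_)
      (lintegral_rpow_enorm_lt_top_of_eLpNorm_lt_top hp0 hp hf.2).ne ?_
    · exact ENNReal.rpow_le_rpow (enorm_indicator_le_enorm_self f x) hp0'.le
    · filter_upwards [h] with x hx
      refine tendsto_const_nhds.congr' ?_
      filter_upwards [hx] with n hn
      rw [indicator_of_notMem hn, enorm_zero, ENNReal.zero_rpow_of_pos hp0']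
  rw [lintegral_zero] at h1
  have h2 := (ENNReal.continuous_rpow_const (y := 1 / p.toReal)).tendsto 0 |>.comp h1
  rw [ENNReal.zero_rpow_of_pos (by positivity)] at h2
  refine h2.congr fun n => ?_
  rw [eLpNorm_eq_lintegral_rpow_enorm_toReal hp0 hp]
  rfl

theorem IsPartition.tendsto_eLpNorm_compl [Fact (1 ≤ p)] (hp : p ≠ ∞) (hK : IsPartition μ K)
    {ν : Measure (Eu d)} (hν : ν ≤ μ) {f : Eu d → Eu D} (hf : MemLp f p ν) :
    Tendsto (fun n => eLpNorm ((⋃ i : Fin (n + 1), K i)ᶜ.indicator f) p ν) atTop (𝓝 0) := by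
  refine tendsto_eLpNorm_of_dominated Fact.out hp hf
    (fun n => (hK.isCompact_iUnion _).measurableSet.compl) ?_
  have h : ∀ᵐ x ∂μ, x ∉ (⋃ n, K n)ᶜ := measure_eq_zero_iff_ae_notMem.1 hK.compl_null
  filter_upwards [(Measure.absolutelyContinuous_of_le hν).ae_le h] with x hx
  obtain ⟨m, hm⟩ := mem_iUnion.1 (not_not.1 hx)
  filter_upwards [eventually_ge_atTop m] with n hn
  exact not_not.2 (mem_iUnion.2 ⟨⟨m, by omega⟩, hm⟩)

/-- The number of sets is kept constant when finitely many already carry `f`: convergence for `τ_∞`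
is obtained inside a single `L^p_{μ:m}`. -/
theorem exists_seq_exhausting [Fact (1 ≤ p)] (hp : p ≠ ∞) (hK : IsPartition μ K)
    (f : LpLoc d D p μ) :
    ∃ N : ℕ → ℕ, (∀ k, 1 ≤ N k) ∧
      (f ∈ compositeUnion D p μ K → ∃ m, 1 ≤ m ∧ f ∈ compositeSet D p μ K m ∧ ∀ k, N k = m) ∧
      ∀ ν ≤ μ, MemLp f.fn p ν →
        Tendsto (fun k => eLpNorm ((⋃ i : Fin (N k), K i)ᶜ.indicator f.fn) p ν) atTop (𝓝 0) := by
  by_cases hf : f ∈ compositeUnion D p μ K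
  · obtain ⟨m, hm, hfm⟩ := hf
    refine ⟨fun _ => m, fun _ => hm, fun _ => ⟨m, hm, hfm, fun _ => rfl⟩, fun ν hν _ => ?_⟩
    have h0 : (⋃ i : Fin m, K i)ᶜ.indicator f.fn =ᵐ[ν] 0 := by
      filter_upwards [(Measure.absolutelyContinuous_of_le hν).ae_le
        (ae_eq_zero_of_essSupport_subset hfm)] with x hx
      by_cases hxS : x ∈ ⋃ i : Fin m, K i
      · exact indicator_of_notMem (not_not.2 hxS) _
      · rw [indicator_of_mem (mem_compl hxS), hx hxS]
        rfl
    simp only [eLpNorm_congr_ae h0, eLpNorm_zero]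
    exact tendsto_const_nhds
  · exact ⟨fun k => k + 1, fun k => Nat.le_add_left 1 k, fun h => absurd h hf,
      fun ν hν hfν => hK.tendsto_eLpNorm_compl hp hν hfν⟩

/-- The quantifier over `ν` lets one sequence serve every topology: `ν = μ` for `τ_∞` and `L^p_μ`,
and `ν = μ.restrict C` for `τ_loc`. -/
theorem exists_seq_tope [Fact (1 ≤ p)] (hp : p ≠ ∞) (hK : IsPartition μ K)
    (hKμ : ∀ n, μ (K n) < ∞) {σ : ℝ → ℝ} (hσ : Continuous σ)
    (hpoly : ¬ ∃ P : ℝ[X], ∀ x, σ x = P.eval x) {J : ℕ} (hJ : 1 ≤ J) (f : LpLoc d D p μ) :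
    ∃ G : ℕ → Lp (Eu D) p μ, (∀ k, ofLp (G k) ∈ tope p μ K (NN σ d D J)) ∧
      (f ∈ compositeUnion D p μ K → ∃ m, 1 ≤ m ∧ f ∈ compositeSet D p μ K m ∧
        ∀ k, ofLp (G k) ∈ compositeSet D p μ K m) ∧
      ∀ ν ≤ μ, MemLp f.fn p ν →
        Tendsto (fun k => eLpNorm (⇑(G k) - f.fn) p ν) atTop (𝓝 0) := by
  obtain ⟨N, hN, hNf, hNt⟩ := exists_seq_exhausting hp hK f
  -- At `k = 0` the tolerance is `∞`, which is harmless.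
  choose G hG hG0 hGf using fun k : ℕ => exists_tope_approx hp hK hKμ hσ hpoly hJ f (hN k)
    (ε := (k : ℝ≥0∞)⁻¹) (ENNReal.inv_ne_zero.2 (ENNReal.natCast_ne_top k))
  refine ⟨G, hG, fun hf => ?_, fun ν hν hfν => ?_⟩
  · obtain ⟨m, hm, hfm, hNm⟩ := hNf hf
    refine ⟨m, hm, hfm, fun k => ?_⟩
    have := hG0 k
    rw [hNm k] at this
    exact essSupport_subset (hK.isCompact_iUnion m).isClosed this
  · have h0 : Tendsto (fun k : ℕ => (k : ℝ≥0∞)⁻¹ +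
        eLpNorm ((⋃ i : Fin (N k), K i)ᶜ.indicator f.fn) p ν) atTop (𝓝 0) := by
      simpa using ENNReal.tendsto_inv_nat_nhds_zero.add (hNt ν hν hfν)
    refine tendsto_of_tendsto_of_tendsto_of_le_of_le tendsto_const_nhds h0
      (fun _ => zero_le) fun k => ?_
    have hS := (hK.isCompact_iUnion (N k)).measurableSet
    have h1 : f.fn - ⇑(G k) = ((⋃ i : Fin (N k), K i).indicator f.fn - G k) +
        (⋃ i : Fin (N k), K i)ᶜ.indicator f.fn := by
      conv_lhs => rw [← indicator_self_add_compl (⋃ i : Fin (N k), K i) f.fn]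
      abel
    dsimp only
    rw [eLpNorm_sub_comm, h1]
    refine (eLpNorm_add_le ((hfν.1.indicator hS).sub ((Lp.aestronglyMeasurable (G k)).mono_measure hν))
      (hfν.1.indicator hS.compl) Fact.out).trans ?_
    gcongr
    exact (eLpNorm_mono_measure _ hν).trans (hGf k)

theorem memLp_of_mem_compositeSet (hK : IsPartition μ K) {f : LpLoc d D p μ} {m : ℕ}
    (hf : f ∈ compositeSet D p μ K m) : MemLp f.fn p μ := by
  have hS := hK.isCompact_iUnion m
  refine ((memLp_indicator_iff_restrict hS.measurableSet).2 (f.2 _ hS)).ae_eq ?_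
  filter_upwards [ae_eq_zero_of_essSupport_subset hf] with x hx
  by_cases hxS : x ∈ ⋃ i : Fin m, K i
  · rw [indicator_of_mem hxS]; rfl
  · rw [indicator_of_notMem hxS, hx hxS]

theorem compositeNorm_le (n : ℕ) (f : Eu d → Eu D) : compositeNorm p μ K n f ≤ eLpNorm f p μ :=
  iSup_le fun _ => eLpNorm_indicator_le f

theorem dense_tope_tauStrict [Fact (1 ≤ p)] (hp : p ≠ ∞) (hK : IsPartition μ K)
    (hKμ : ∀ n, μ (K n) < ∞) {σ : ℝ → ℝ} (hσ : Continuous σ)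
    (hpoly : ¬ ∃ P : ℝ[X], ∀ x, σ x = P.eval x) {J : ℕ} (hJ : 1 ≤ J) :
    DenseFor (tauStrict D p μ K) (tope p μ K (NN σ d D J)) := by
  let _ := tauStrict D p μ K
  intro f
  obtain ⟨G, hG, hGc, hGf⟩ := exists_seq_tope (D := D) hp hK hKμ hσ hpoly hJ f
  refine mem_closure_of_tendsto (f := fun k => ofLp (G k)) (b := atTop) ?_ (Eventually.of_forall hG)
  -- Only generating open sets containing `f` matter; one coming from `τ_∞` or `L^p_μ` forces `f`
  -- into the corresponding subspace.
  refine TopologicalSpace.tendsto_nhds_generateFrom_iff.2 ?_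
  rintro _ ((⟨U, hU, rfl⟩ | ⟨V, hV, rfl⟩) | hO) hfO
  · obtain ⟨u, hu, rfl⟩ := hfO
    obtain ⟨m, hm, hfm, hGm⟩ := hGc u.2
    have hUm := isOpen_coinduced.1 (isOpen_iSup_iff.1 (isOpen_iSup_iff.1 hU m) hm)
    obtain ⟨ε, hε, hεU⟩ := hUm ⟨u.1, hfm⟩ hu
    have ht := hGf μ le_rfl (memLp_of_mem_compositeSet hK hfm)
    filter_upwards [ht.eventually_lt_const hε] with k hk
    exact ⟨_, hεU ⟨ofLp (G k), hGm k⟩ ((compositeNorm_le m _).trans_lt hk), rfl⟩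
  · obtain ⟨F, hF, rfl⟩ := hfO
    have ht := (Lp.tendsto_Lp_iff_tendsto_eLpNorm' G F).2 (hGf μ le_rfl (Lp.memLp F))
    filter_upwards [ht.eventually_mem (hV.mem_nhds hF)] with k hk using ⟨_, hk, rfl⟩
  · have ht : Tendsto (fun k => ofLp (G k)) atTop (@nhds _ (tauLoc d D p μ) f) := by
      simp only [nhds_iInf, nhds_induced, tendsto_iInf, tendsto_comap_iff]
      intro C hC
      exact (Lp.tendsto_Lp_iff_tendsto_eLpNorm'' _ (fun k => (ofLp (G k)).2 C hC) _ (f.2 C hC)).2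
        (hGf _ Measure.restrict_le_self (f.2 C hC))
    exact ht (@IsOpen.mem_nhds _ (tauLoc d D p μ) _ _ hO hfO)

theorem exists_tope_lintegral_lt [Fact (1 ≤ p)] (hp : p ≠ ∞) (hK : IsPartition μ K)
    (hKμ : ∀ n, μ (K n) < ∞) {σ : ℝ → ℝ} (hσ : Continuous σ)
    (hpoly : ¬ ∃ P : ℝ[X], ∀ x, σ x = P.eval x) {J : ℕ} (hJ : 1 ≤ J) {ε : ℝ≥0∞} (hε : 0 < ε)
    {f : Eu d → Eu D} (hf : MemLp f p μ) :
    ∃ g ∈ tope p μ K (NN σ d D J), ∫⁻ x, ‖f x - g.fn x‖ₑ ^ p.toReal ∂μ < ε := by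
  have hp0 : p ≠ 0 := (zero_lt_one.trans_le (Fact.out : 1 ≤ p)).ne'
  have hp0' : 0 < p.toReal := ENNReal.toReal_pos hp0 hp
  obtain ⟨G, hG, -, hGf⟩ := exists_seq_tope hp hK hKμ hσ hpoly hJ (ofLp hf.toLp)
  have ht := (ENNReal.continuous_rpow_const (y := p.toReal)).tendsto 0 |>.comp
    (hGf μ le_rfl (Lp.memLp hf.toLp))
  rw [ENNReal.zero_rpow_of_pos hp0'] at ht
  obtain ⟨k, hk⟩ := (ht.eventually_lt_const hε).exists
  refine ⟨_, hG k, lt_of_eq_of_lt ?_ hk⟩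
  have h1 : ⇑(G k) - (ofLp hf.toLp).fn =ᵐ[μ] ⇑(G k) - f := by
    filter_upwards [hf.coeFn_toLp] with x hx
    rw [Pi.sub_apply, ofLp_fn, hx, Pi.sub_apply]
  rw [Function.comp_apply, eLpNorm_congr_ae h1, eLpNorm_sub_comm,
    eLpNorm_eq_lintegral_rpow_enorm_toReal hp0 hp, ← ENNReal.rpow_mul,
    one_div_mul_cancel hp0'.ne', ENNReal.rpow_one]
  rfl

end Strict

/-! ### Comparison of architopes with networks. -/

section Converse

variable {d D : ℕ} {p : ℝ≥0∞} {μ : Measure (Eu d)} {K : ℕ → Set (Eu d)}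

theorem NN_mono (σ : ℝ → ℝ) (d D : ℕ) {i j : ℕ} (h : i ≤ j) : NN σ d D i ⊆ NN σ d D j :=
  fun _ ⟨k, hk, hki, hf⟩ => ⟨k, hk, hki.trans h, hf⟩

theorem classes_mono {F G : Set (Eu d → Eu D)} (h : F ⊆ G) : classes p μ F ⊆ classes p μ G :=
  fun _ ⟨f, hf, hgf⟩ => ⟨f, h hf, hgf⟩

/-- Use the same `f` on `K 0` and on its complement, with coefficients 1. -/
theorem classes_subset_tope (F : Set (Eu d → Eu D)) : classes p μ F ⊆ tope p μ K F := by
  rintro g ⟨f, hf, hgf⟩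
  refine ⟨1, fun _ => 1, fun _ => f, 1, f, le_rfl, fun _ => hf, hf, Or.inl one_ne_zero,
    hgf.trans (Eventually.of_forall fun x => ?_)⟩
  have hU : (⋃ i : Fin 1, K i) = K 0 := iSup_unique _
  simp only [architopeFn, Finset.univ_unique, Finset.sum_singleton, one_smul, hU]
  exact (congrFun (indicator_self_add_compl (K 0) f) x).symm

/-- In the particular-point topology at `g ∈ B \ A`, a set is dense exactly when it contains `g`. -/
theorem exists_topology_separating {X : Type*} {A B : Set X} (hAB : A ⊆ B) (hne : A ≠ B) :
    ∃ τ : TopologicalSpace X, DenseFor τ B ∧ ∀ C ⊆ A, ¬ DenseFor τ C := by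
  obtain ⟨g, hgB, hgA⟩ := exists_of_ssubset (hAB.ssubset_of_ne hne)
  let τ : TopologicalSpace X :=
    { IsOpen := fun U => U.Nonempty → g ∈ U
      isOpen_univ := fun _ => mem_univ g
      isOpen_inter := fun U V hU hV h =>
        ⟨hU (h.mono inter_subset_left), hV (h.mono inter_subset_right)⟩
      isOpen_sUnion := by
        rintro S hS ⟨x, U, hUS, hxU⟩
        exact ⟨U, hUS, hS U hUS ⟨x, hxU⟩⟩ }
  refine ⟨τ, dense_iff_inter_open.2 fun U hU hne => ⟨g, hU hne, hgB⟩, fun C hC hd => ?_⟩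
  obtain ⟨x, hx, hxC⟩ := dense_iff_inter_open.1 hd {g} (fun _ => rfl) ⟨g, rfl⟩
  exact hgA (hx ▸ hC hxC)

/-- The hidden layer has width 0. -/
theorem isNetwork_const (σ : ℝ → ℝ) (c : Eu D) : IsNetwork σ d D 1 fun _ => c :=
  ⟨0, _, AffineMap.const ℝ (Eu 0) c, IsHidden.layer IsHidden.input (AffineMap.const ℝ (Eu d) 0), rfl⟩

/-- A nonzero constant on one set of the partition, extended by zero, has no continuous version on
a connected support. -/
theorem not_ae_eq_indicator_of_continuous (hK : IsPartition μ K) (hKμ : ∀ n, 0 < μ (K n))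
    (hconn : IsPreconnected μ.support) {c : Eu D} (hc : c ≠ 0) {h : Eu d → Eu D}
    (hh : Continuous h) : ¬ h =ᵐ[μ] (K 0).indicator fun _ => c := by
  intro hae
  have hpos : ∀ n, ∃ x ∈ μ.support, x ∈ K n ∧ h x = (K 0).indicator (fun _ => c) x ∧
      ∀ m, n ≠ m → x ∉ K m := by
    intro n
    have h1 : ∀ᵐ x ∂μ, ∀ m, n ≠ m → x ∉ K n ∩ K m := ae_all_iff.2 fun m => by
      by_cases hnm : n = m
      · exact Eventually.of_forall fun x h => absurd hnm h
      · filter_upwards [measure_eq_zero_iff_ae_notMem.1 (hK.inter_null n m hnm)] with x hx _ using hx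
    have h2 : ∃ᵐ x ∂μ, x ∈ K n := frequently_ae_mem_iff.2 (hKμ n).ne'
    obtain ⟨x, hx, hxs, hxe, hxm⟩ :=
      (h2.and_eventually ((show ∀ᵐ x ∂μ, x ∈ μ.support from Measure.support_mem_ae).and
        (hae.and h1))).exists
    exact ⟨x, hxs, hx, hxe, fun m hnm hm => hxm m hnm ⟨hx, hm⟩⟩
  have hval : ∀ x ∈ μ.support, h x = 0 ∨ h x = c := by
    intro x hx
    by_contra hne
    -- The set where `h` avoids `0` and `c` is open and null, so it misses the support.
    have hopen : IsOpen {y | ¬ (h y = 0 ∨ h y = c)} := by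
      have : {y | ¬ (h y = 0 ∨ h y = c)} = (h ⁻¹' {0, c})ᶜ := by ext y; simp
      rw [this]
      exact ((toFinite {0, c}).isClosed.preimage hh).isOpen_compl
    refine ((Measure.mem_support_iff_forall x).1 hx _ (hopen.mem_nhds hne)).ne' ?_
    refine measure_mono_null ?_ hae
    intro y hy hye
    refine hy ?_
    rw [show h y = _ from hye]
    by_cases hy0 : y ∈ K 0
    · exact Or.inr (indicator_of_mem hy0 _)
    · exact Or.inl (indicator_of_notMem hy0 _)
  obtain ⟨x, hxs, hx0, hxe, -⟩ := hpos 0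
  obtain ⟨y, hys, hy1, hye, hy0⟩ := hpos 1
  rw [indicator_of_mem hx0] at hxe
  rw [indicator_of_notMem (hy0 0 one_ne_zero)] at hye
  have hsub : h '' μ.support ⊆ {0, c} := by
    rintro _ ⟨z, hz, rfl⟩
    exact hval z hz
  -- A preconnected subset of `{0, c}` has at most one point, yet both values are attained, on `K 1`
  -- and on `K 0`.
  exact hc (((toFinite {0, c}).subset hsub).countable.isTotallyDisconnected _ subset_rfl
    (hconn.image h hh.continuousOn) ⟨x, hxs, hxe⟩ ⟨y, hys, hye⟩)

theorem classes_ne_tope [Fact (1 ≤ p)] (hD : 0 < D) (hK : IsPartition μ K)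
    (hKμ : ∀ n, 0 < μ (K n) ∧ μ (K n) < ∞) {σ : ℝ → ℝ} (hσ : Continuous σ) {J : ℕ} (hJ : 1 ≤ J)
    (hconn : IsPreconnected μ.support) : classes p μ (NN σ d D J) ≠ tope p μ K (NN σ d D J) := by
  intro heq
  let c : Eu D := EuclideanSpace.single ⟨0, hD⟩ 1
  have hc : c ≠ 0 := fun h => by simpa [c] using congrArg (fun v : Eu D => v ⟨0, hD⟩) h
  have hconst : (fun _ => c) ∈ NN σ d D J := ⟨1, le_rfl, hJ, isNetwork_const σ c⟩
  have hmem : MemLp ((K 0).indicator fun _ => c) p μ :=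
    continuous_const.memLp_indicator_of_isCompact (hK.isCompact 0) (hKμ 0).2
  have hg : ofLp hmem.toLp ∈ tope p μ K (NN σ d D J) := by
    refine ⟨1, fun _ => 1, fun _ _ => c, 0, fun _ => c, le_rfl, fun _ => hconst, hconst,
      Or.inr ⟨0, one_ne_zero⟩, ?_⟩
    filter_upwards [hmem.coeFn_toLp] with x hx
    rw [ofLp_fn, hx]
    simp [architopeFn]
  rw [← heq] at hg
  obtain ⟨f, ⟨j, -, -, hf⟩, hgf⟩ := hg
  exact not_ae_eq_indicator_of_continuous hK (fun n => (hKμ n).1) hconn hc (hf.continuous hσ)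
    (hgf.symm.trans hmem.coeFn_toLp)

end Converse

end Architope

theorem mainTheorem9
    (d D : ℕ) (hD : 0 < D)
    (p : ℝ≥0∞) [Fact (1 ≤ p)] (hp : p ≠ ∞)
    (μ : Measure (Eu d)) [SigmaFinite μ] (hμ : μ ≪ volume)
    (K : ℕ → Set (Eu d)) (hK : IsPartition μ K) (hKμ : ∀ n, 0 < μ (K n) ∧ μ (K n) < ∞)
    (σ : ℝ → ℝ) (hσ : Continuous σ) (hpoly : ¬ ∃ P : Polynomial ℝ, ∀ x, σ x = P.eval x)
    (J : ℕ) (hJ : 1 ≤ J) :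
    -- (i)
    DenseFor (tauStrict D p μ K) (tope p μ K (NN σ d D J)) ∧
    -- (ii)
    (∀ δ : ℝ, 0 < δ → ∀ f : Eu d → Eu D, MemLp f p μ →
      ∃ g ∈ tope p μ K (NN σ d D J),
        ∫⁻ x, ‖f x - g.fn x‖ₑ ^ p.toReal ∂μ < ENNReal.ofReal δ) ∧
    -- (iii), the implication
    (∀ (τ : TopologicalSpace (LpLoc d D p μ)) (j : ℕ), 1 ≤ j → j ≤ J →
      DenseFor τ (classes p μ (NN σ d D j)) → DenseFor τ (tope p μ K (NN σ d D J))) ∧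
    -- (iii), failure of the converse
    (classes p μ (NN σ d D J) ≠ tope p μ K (NN σ d D J) →
      ∃ τ : TopologicalSpace (LpLoc d D p μ), DenseFor τ (tope p μ K (NN σ d D J)) ∧
        ∀ j : ℕ, 1 ≤ j → j ≤ J → ¬ DenseFor τ (classes p μ (NN σ d D j))) ∧
    (IsPreconnected μ.support → classes p μ (NN σ d D J) ≠ tope p μ K (NN σ d D J)) := by
  have hKf : ∀ n, μ (K n) < ∞ := fun n => (hKμ n).2
  refine ⟨dense_tope_tauStrict hp hK hKf hσ hpoly hJ, fun δ hδ f hf =>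
    exists_tope_lintegral_lt hp hK hKf hσ hpoly hJ (ENNReal.ofReal_pos.2 hδ) hf,
    fun τ j _ hj hd => ?_, fun hne => ?_, classes_ne_tope hD hK hKμ hσ hJ⟩
  · exact @Dense.mono _ τ _ _ ((classes_mono (NN_mono σ d D hj)).trans (classes_subset_tope _)) hd
  · obtain ⟨τ, hτ, h⟩ := exists_topology_separating (classes_subset_tope _) hne
    exact ⟨τ, hτ, fun j _ hj => h _ (classes_mono (NN_mono σ d D hj))⟩
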